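/- For an integer $\Delta<0$ let $\mathcal{T}_\Delta$ be the (finite) set of $(a,b,c)\in\mathbb{Z}^3$ such that $aX^2+bXY+cY^2$ is a primitive, positive definite binary quadratic form of discriminant $b^2-4ac=\Delta$ that is reduced, i.e. $|b|\le a\le c$, and $b\ge 0$ whenever $|b|=a$ or $a=c$. Let $\overline{\mathcal{F}}=\{\tau\in\mathbb{C} : \operatorname{Im}\tau>0,\ |\operatorname{Re}\tau|\le 1/2,\ |\tau|\ge 1\}$ be the closed standard fundamental domain of $\mathrm{SL}_2(\mathbb{Z})$ acting on the upper half-plane. For $\xi\in\overline{\mathcal{F}}$ and $\varepsilon>0$ put $$\mathcal{C}(\Delta;\xi;\varepsilon)=\#\left\{(a,b,c)\in\mathcal{T}_\Delta : \left|\frac{-b+\Delta^{1/2}}{2a}-\xi\right|<\varepsilon\right\},\qquad \Delta^{1/2}=i\,|\Delta|^{1/2},$$ and put $F(\Delta)=\max\{2^{\omega(a)} : a\in\mathbb{Z},\ 1\le a\le|\Delta|^{1/2}\}$, where $\omega(a)$ is the number of distinct prime divisors of $a$. Then for every integer $\Delta<0$ with $|\Delta|\ge 10^{14}$, every $\xi\in\overline{\mathcal{F}}$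 and every $0<\varepsilon<1/4$, $$\mathcal{C}(\Delta;\xi;\varepsilon)\le F(\Delta)\left(32\,|\Delta|^{1/2}\varepsilon^2\log\log\left(|\Delta|^{1/2}\right)+11\,|\Delta|^{1/2}\varepsilon+2\right).$$ -/

import Mathlib

open scoped Modular ArithmeticFunction.omega

/-- The integral binary quadratic form `a X² + b X Y + c Y²` is positive definite, that is,
its leading coefficient is positive and its discriminant is negative. -/
def IsPosDefForm (a b c : ℤ) : Prop :=
  0 < a ∧ b ^ 2 - 4 * a * c < 0

/-- The form `a X² + b X Y + c Y²` is primitive: its coefficients have no common factor. -/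
def IsPrimitiveForm (a b c : ℤ) : Prop :=
  Int.gcd (Int.gcd a b) c = 1

/-- The form `a X² + b X Y + c Y²` is reduced: `|b| ≤ a ≤ c`, and `b ≥ 0` as soon as one of
these inequalities is an equality. -/
def IsReducedForm (a b c : ℤ) : Prop :=
  |b| ≤ a ∧ a ≤ c ∧ (|b| = a ∨ a = c → 0 ≤ b)

/-- The set of coefficients `(a, b, c)` of the reduced, primitive, positive definite binary
quadratic forms of discriminant `Δ`. -/
def reducedForms (Δ : ℤ) : Set (ℤ × ℤ × ℤ) :=
  {q | IsPosDefForm q.1 q.2.1 q.2.2 ∧ IsPrimitiveForm q.1 q.2.1 q.2.2 ∧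
    IsReducedForm q.1 q.2.1 q.2.2 ∧ q.2.1 ^ 2 - 4 * q.1 * q.2.2 = Δ}

/-- There are only finitely many reduced forms of a given discriminant, so that cardinalities
of subsets of `reducedForms Δ` may be taken with `Set.ncard`. -/
theorem reducedForms_finite (Δ : ℤ) : (reducedForms Δ).Finite := by
  apply Set.Finite.subset
    ((Set.finite_Icc (0 : ℤ) (-Δ)).prod
      ((Set.finite_Icc (Δ) (-Δ)).prod (Set.finite_Icc (0 : ℤ) (-Δ))))
  rintro ⟨a, b, c⟩ ⟨⟨ha, -⟩, -, ⟨hb, hac, -⟩, hD⟩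
  simp only at ha hb hac hD
  have hb' := abs_le.mp hb
  have h1 : b ^ 2 ≤ a * a := by nlinarith
  have h2 : a * a ≤ a * c := by nlinarith
  have h3 : c ≤ a * c := by nlinarith
  have h4 : c ≤ -Δ := by nlinarith
  simp only [Set.mem_prod, Set.mem_Icc]
  refine ⟨⟨?_, ?_⟩, ⟨?_, ?_⟩, ?_, ?_⟩ <;> linarith

/-- The point `(-b + Δ^{1/2}) / (2a)`, where for `Δ < 0` the root is `Δ^{1/2} = i |Δ|^{1/2}`. -/
noncomputable def formPoint (Δ a b : ℤ) : ℂ :=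
  (-(b : ℂ) + Complex.I * (√|(Δ : ℝ)| : ℝ)) / (2 * (a : ℂ))

/-- The number of reduced, primitive, positive definite forms `(a, b, c)` of discriminant `Δ`
with `|(-b + Δ^{1/2}) / (2a) - ξ| < ε`. -/
noncomputable def cmCount (Δ : ℤ) (ξ : UpperHalfPlane) (ε : ℝ) : ℕ :=
  {q ∈ reducedForms Δ | ‖formPoint Δ q.1 q.2.1 - (ξ : ℂ)‖ < ε}.ncard

/-- The maximum of `2 ^ ω(a)` over the positive integers `a ≤ |Δ|^{1/2}`, where `ω(a)` is the
number of distinct prime divisors of `a`. -/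
noncomputable def maxTwoPowOmega (Δ : ℤ) : ℕ :=
  (Finset.Icc 1 ⌊√|(Δ : ℝ)|⌋₊).sup fun a => 2 ^ ω a

/-! Put X = |Δ|^{1/2}. For a counted form, the imaginary part of its point confines a to an interval
of length l ≤ (16/11)Xε, and the real part confines b to one of length 4aε. Moreover b² ≡ Δ mod 4a,
and (a, b) determines c. For fixed a let g(a)² be the largest square dividing gcd(a, Δ). The
admissible b fill at most 2^ω(a) classes modulo 2a/g(a) (`card_sqrt_mod_le`), which gives at most
F(2ε g(a) + 1) forms. It remains to sum g(a). If f² is the largest square dividing Δ, then g(a) ∣ f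
and g(a)² ∣ a, so counting multiples of d² for d ∣ f bounds the sum by l·∑_{d∣f} 1/d + X
(`sum_squareDivisor_le`). The divisor sum is O(log log X), with explicit constants, by an elementary
argument with Λ (`sum_divisors_inv_le`). -/

/-! ### Square roots of Δ modulo 4a in short intervals -/

/-- Pairwise congruent integers modulo `M` lying in an open interval of length `l` are at most
`l / M + 1` in number. -/
theorem card_le_of_dvd_sub (T : Finset ℤ) (M : ℤ) (hM : 0 < M) (x l : ℝ) (hl : 0 ≤ l)
    (hx : ∀ t ∈ T, x < t ∧ (t : ℝ) < x + l) (hd : ∀ s ∈ T, ∀ t ∈ T, M ∣ s - t) :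
    (T.card : ℝ) ≤ l / M + 1 := by
  have hM' : (0 : ℝ) < M := by exact_mod_cast hM
  rcases T.eq_empty_or_nonempty with rfl | hT
  · simp; positivity
  set t₀ := T.min' hT
  have h₀ : t₀ ∈ T := T.min'_mem hT
  have key : T.card ≤ (Finset.range (⌊l / M⌋₊ + 1)).card := by
    apply Finset.card_le_card_of_injOn (fun t => ((t - t₀) / M).toNat)
    · intro t ht
      have h1 : t₀ ≤ t := T.min'_le t ht
      obtain ⟨k, hk⟩ := hd t ht t₀ h₀
      have hk0 : 0 ≤ k := by
        by_contra hneg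
        have : M * k < 0 := mul_neg_of_pos_of_neg hM (by omega)
        omega
      have e : (t - t₀) / M = k := by rw [hk]; exact Int.mul_ediv_cancel_left _ hM.ne'
      simp only [e, Finset.coe_range, Set.mem_Iio, Nat.lt_succ_iff]
      apply Nat.le_floor
      rw [le_div_iff₀ hM']
      have h2 := (hx t ht).2
      have h3 := (hx t₀ h₀).1
      have h4 : (t : ℝ) - t₀ = M * k := by exact_mod_cast hk
      have h5 : ((k.toNat : ℕ) : ℝ) = k := by
        exact_mod_cast (show ((k.toNat : ℕ) : ℤ) = k from Int.toNat_of_nonneg hk0)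
      rw [h5]; linarith
    · intro s hs t ht hst
      have h1 : t₀ ≤ t := T.min'_le t ht
      have h2 : t₀ ≤ s := T.min'_le s hs
      have e1 : 0 ≤ (s - t₀) / M := Int.ediv_nonneg (by omega) hM.le
      have e2 : 0 ≤ (t - t₀) / M := Int.ediv_nonneg (by omega) hM.le
      have e3 : (s - t₀) / M = (t - t₀) / M := by
        have : ((s - t₀) / M).toNat = ((t - t₀) / M).toNat := hst
        omega
      have e4 := Int.ediv_mul_cancel (hd s hs t₀ h₀)
      have e5 := Int.ediv_mul_cancel (hd t ht t₀ h₀)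
      rw [e3] at e4
      omega
  rw [Finset.card_range] at key
  calc (T.card : ℝ) ≤ ((⌊l / M⌋₊ + 1 : ℕ) : ℝ) := by exact_mod_cast key
    _ ≤ l / M + 1 := by
      push_cast
      have := Nat.floor_le (show 0 ≤ l / M by positivity)
      linarith

theorem dvd_of_sq_dvd_sq_mul {d f s : ℕ} (hs : Squarefree s) (h : d ^ 2 ∣ f ^ 2 * s) : d ∣ f := by
  rcases Nat.eq_zero_or_pos f with rfl | hf
  · simp
  obtain ⟨g, d', f', hg, hc, hd', hf'⟩ := Nat.exists_coprime' (m := d) (n := f)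
    (Nat.gcd_pos_of_pos_right _ hf)
  subst hd' hf'
  have h1 : d' ^ 2 * g ^ 2 ∣ (f' ^ 2 * s) * g ^ 2 := by
    convert h using 1 <;> ring
  have h2 : d' ^ 2 ∣ f' ^ 2 * s := Nat.dvd_of_mul_dvd_mul_right (by positivity) h1
  have h3 : d' ^ 2 ∣ s := (Nat.Coprime.pow 2 2 hc).dvd_of_dvd_mul_left h2
  have h4 : IsUnit d' := hs d' (by rwa [← sq])
  rw [Nat.isUnit_iff] at h4
  subst h4
  simp

/-- If both failed, the p-adic valuations of u and v would add up to at most (i - 1) + (j - 1) < k.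
-/
theorem pow_dvd_or_pow_dvd {p k i j : ℕ} (hp : p.Prime) {u v : ℤ} (h : (p : ℤ) ^ k ∣ u * v)
    (hij : i + j ≤ k + 1) : (p : ℤ) ^ i ∣ u ∨ (p : ℤ) ^ j ∣ v := by
  have hp' : Prime (p : ℤ) := Nat.prime_iff_prime_int.mp hp
  induction i with
  | zero => simp
  | succ i ih =>
    rcases ih (by omega) with ⟨w, rfl⟩ | hv
    · by_cases hw : (p : ℤ) ∣ w
      · left; rw [pow_succ]; exact mul_dvd_mul_left _ hw
      · right
        have h1 : (p : ℤ) ^ i * (p : ℤ) ^ (k - i) ∣ (p : ℤ) ^ i * (w * v) := by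
          rw [← pow_add, Nat.add_sub_cancel' (by omega), ← mul_assoc]; exact h
        have h2 := (mul_dvd_mul_iff_left (pow_ne_zero i hp'.ne_zero)).mp h1
        exact (pow_dvd_pow _ (by omega)).trans (hp'.pow_dvd_of_dvd_mul_left _ hw h2)
    · exact Or.inr hv

/-- For two square roots `b`, `b₀` of `Δ` modulo `4a`, each prime power of `a / g`
divides `(b - b₀) / 2` or `(b + b₀) / 2`, where `g ^ 2` is the
largest square dividing `gcd(a, Δ)`. -/
theorem prime_pow_dvd_half_sub_or {a g s p : ℕ} (hs : Squarefree s) (ha : 0 < a) {Δ u v : ℤ}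
    (hgs : g ^ 2 * s = Nat.gcd a Δ.natAbs) (huv : (a : ℤ) ∣ u * v)
    (hΔ : (4 * a : ℤ) ∣ (u + v) ^ 2 - Δ) (hp : p.Prime) :
    (p : ℤ) ^ (a / g).factorization p ∣ u ∨ (p : ℤ) ^ (a / g).factorization p ∣ v := by
  have hga : g ∣ a := (Dvd.intro _ rfl : g ∣ g * (g * s)).trans
    (by rw [show g * (g * s) = g ^ 2 * s by ring, hgs]; exact Nat.gcd_dvd_left _ _)
  have hg0 : g ≠ 0 := by rintro rfl; simp at hga; omega
  rw [Nat.factorization_div hga]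
  simp only [Finsupp.coe_tsub, Pi.sub_apply]
  set k := a.factorization p
  set t := g.factorization p
  have hpk : (p : ℤ) ^ k ∣ u * v :=
    dvd_trans (by exact_mod_cast Nat.ordProj_dvd a p) huv
  have htk : t ≤ k := (Nat.factorization_le_iff_dvd hg0 ha.ne').mpr hga p
  -- If p^(k-t) divides neither factor, then p^(t+1) divides both and 2(t+1) ≤ k. Hence p^(2(t+1))
  -- divides a and (u+v)², so also Δ, which forces p^(t+1) ∣ g against the choice of t.
  by_contra! hcon
  obtain ⟨hu, hv⟩ := hcon
  have hv1 : (p : ℤ) ^ (t + 1) ∣ v :=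
    (pow_dvd_or_pow_dvd hp hpk (by omega)).resolve_left hu
  have hu1 : (p : ℤ) ^ (t + 1) ∣ u :=
    (pow_dvd_or_pow_dvd hp (mul_comm u v ▸ hpk) (by omega)).resolve_left hv
  have hk2 : (t + 1) * 2 ≤ k := by
    by_contra hlt
    exact ((pow_dvd_or_pow_dvd hp hpk (i := k - t) (j := k - t) (by omega))).elim hu hv
  have hpa : p ^ ((t + 1) * 2) ∣ a := (pow_dvd_pow p hk2).trans (Nat.ordProj_dvd a p)
  have hpΔ : p ^ ((t + 1) * 2) ∣ Δ.natAbs := by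
    rw [← Int.natCast_dvd]
    have h1 : ((p ^ ((t + 1) * 2) : ℕ) : ℤ) ∣ (u + v) ^ 2 := by
      push_cast; rw [pow_mul]; exact pow_dvd_pow_of_dvd (dvd_add hu1 hv1) 2
    have h2 : ((p ^ ((t + 1) * 2) : ℕ) : ℤ) ∣ (u + v) ^ 2 - Δ :=
      (Int.natCast_dvd_natCast.mpr hpa).trans ((Dvd.intro_left _ rfl).trans hΔ)
    simpa using dvd_sub h1 h2
  have h3 : (p ^ (t + 1)) ^ 2 ∣ g ^ 2 * s := by
    rw [hgs, ← pow_mul]; exact Nat.dvd_gcd hpa hpΔ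
  have h4 := dvd_of_sq_dvd_sq_mul hs h3
  have := (hp.pow_dvd_iff_le_factorization hg0).mp h4
  omega

/-- The square roots of `Δ` modulo `4a` form at most `2 ^ ω(a)` residue classes modulo
`2a / g`. -/
theorem card_sqrt_mod_le {a g s : ℕ} (hs : Squarefree s) (ha : 0 < a) {Δ : ℤ}
    (hgs : g ^ 2 * s = Nat.gcd a Δ.natAbs) (B : Finset ℤ) (x l : ℝ) (hl : 0 ≤ l)
    (hB : ∀ b ∈ B, (4 * a : ℤ) ∣ b ^ 2 - Δ) (hx : ∀ b ∈ B, x < b ∧ (b : ℝ) < x + l) :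
    (B.card : ℝ) ≤ 2 ^ ω a * (l * g / (2 * a) + 1) := by
  have hga : g ∣ a := (Dvd.intro _ rfl : g ∣ g * (g * s)).trans
    (by rw [show g * (g * s) = g ^ 2 * s by ring, hgs]; exact Nat.gcd_dvd_left _ _)
  rcases B.eq_empty_or_nonempty with rfl | ⟨b₀, hb₀⟩
  · simp; positivity
  set m := a / g
  have hm : a = g * m := (Nat.mul_div_cancel' hga).symm
  have hm0 : m ≠ 0 := by intro h; rw [h] at hm; simp at hm; omega
  have hg0 : g ≠ 0 := by intro h; rw [h] at hm; simp at hm; omega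
  have half : ∀ b ∈ B, ∃ u : ℤ, b = b₀ + 2 * u := by
    intro b hb
    have h1 : (2 : ℤ) ∣ b ^ 2 - b₀ ^ 2 := by
      have := dvd_sub (hB b hb) (hB b₀ hb₀)
      rw [sub_sub_sub_cancel_right] at this
      exact (Dvd.intro (2 * (a : ℤ)) (by ring)).trans this
    have h2 : Even (b ^ 2 - b₀ ^ 2) := even_iff_two_dvd.mpr h1
    have h3 : Even (b - b₀) := by
      simpa [Int.even_sub, Int.even_pow] using h2
    obtain ⟨u, hu⟩ := even_iff_two_dvd.mp h3
    exact ⟨u, by omega⟩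
  classical
  -- `φ b` records the primes at which b agrees with b₀; at the others b agrees with -b₀. Working
  -- with halves treats p = 2 like any other prime, and `φ b` fixes b modulo 2m.
  let φ : ℤ → Finset ℕ := fun b =>
    a.primeFactors.filter fun p => (p : ℤ) ^ m.factorization p ∣ (b - b₀) / 2
  have hφ : Set.MapsTo φ B a.primeFactors.powerset := fun b _ => by
    exact Finset.mem_coe.mpr (Finset.mem_powerset.mpr (Finset.filter_subset _ _))
  have dich : ∀ u : ℤ, b₀ + 2 * u ∈ B → ∀ p : ℕ, p.Prime →
      (p : ℤ) ^ m.factorization p ∣ u ∨ (p : ℤ) ^ m.factorization p ∣ b₀ + u := by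
    intro u hu p hp
    refine prime_pow_dvd_half_sub_or (Δ := Δ) hs ha hgs ?_ ?_ hp
    · have := dvd_sub (hB _ hu) (hB b₀ hb₀)
      rw [show (b₀ + 2 * u) ^ 2 - Δ - (b₀ ^ 2 - Δ) = 4 * (u * (b₀ + u)) by ring] at this
      exact (mul_dvd_mul_iff_left (by norm_num)).mp this
    · convert hB _ hu using 2; ring
  have fib : ∀ P ∈ a.primeFactors.powerset,
      (({b ∈ B | φ b = P} : Finset ℤ).card : ℝ) ≤ l / ((2 * m : ℤ) : ℝ) + 1 := by
    intro P _
    refine card_le_of_dvd_sub _ (2 * m) (by positivity) x l hl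
      (fun t ht => hx t (Finset.mem_filter.mp ht).1) ?_
    intro b hb b' hb'
    obtain ⟨hb, e⟩ := Finset.mem_filter.mp hb
    obtain ⟨hb', e'⟩ := Finset.mem_filter.mp hb'
    obtain ⟨u, rfl⟩ := half b hb
    obtain ⟨u', rfl⟩ := half b' hb'
    rw [show b₀ + 2 * u - (b₀ + 2 * u') = 2 * (u - u') by ring]
    refine mul_dvd_mul_left 2 (Int.natCast_dvd.mpr ?_)
    rw [Nat.dvd_iff_prime_pow_dvd_dvd]
    intro p k hp hk
    rw [hp.pow_dvd_iff_le_factorization hm0] at hk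
    refine (pow_dvd_pow p hk).trans (Int.natCast_dvd.mp ?_)
    push_cast
    by_cases hpa : p ∈ a.primeFactors
    · have iff : (p : ℤ) ^ m.factorization p ∣ u ↔ (p : ℤ) ^ m.factorization p ∣ u' := by
        have := congrArg (p ∈ ·) (e.trans e'.symm)
        simpa [φ, -Nat.mem_primeFactors, hpa] using this
      by_cases hu : (p : ℤ) ^ m.factorization p ∣ u
      · exact dvd_sub hu (iff.mp hu)
      · have h1 := (dich u hb p hp).resolve_left hu
        have h2 := (dich u' hb' p hp).resolve_left (fun h => hu (iff.mpr h))
        simpa using dvd_sub h1 h2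
    · have : m.factorization p = 0 := by
        apply Nat.factorization_eq_zero_of_not_dvd
        intro h
        exact hpa (Nat.mem_primeFactors.mpr ⟨hp, hm ▸ h.mul_left g, ha.ne'⟩)
      simp [this]
  have hcard : (a.primeFactors.powerset.card : ℝ) = 2 ^ ω a := by
    rw [Finset.card_powerset, ArithmeticFunction.cardDistinctFactors_apply,
      Nat.primeFactors, List.card_toFinset]
    push_cast; rfl
  rw [Finset.card_eq_sum_card_fiberwise hφ, Nat.cast_sum]
  refine (Finset.sum_le_sum fib).trans_eq ?_
  rw [Finset.sum_const, nsmul_eq_mul, hcard]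
  have h3 : (g : ℝ) ≠ 0 := by exact_mod_cast hg0
  have h4 : (m : ℝ) ≠ 0 := by exact_mod_cast hm0
  congr 2
  rw [hm]; push_cast
  field_simp

/-! ### An explicit log log bound for the sum of 1/d over the divisors of f -/

-- Chebyshev's argument: ∑ Λ(n)⌊N/n⌋ = log N!, at most N log N, and N/n ≤ 2⌊N/n⌋ for n ≤ N.
open ArithmeticFunction ArithmeticFunction.zeta in
theorem sum_vonMangoldt_div_le (N : ℕ) :
    ∑ n ∈ Finset.Ioc 0 N, Λ n / n ≤ 2 * Real.log N := by
  rcases Nat.eq_zero_or_pos N with rfl | hN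
  · simp
  have hN' : (0 : ℝ) < N := by exact_mod_cast hN
  have h1 : ∑ n ∈ Finset.Ioc 0 N, Λ n * ((N / n : ℕ) : ℝ) ≤ N * Real.log N := by
    rw [← sum_Ioc_mul_zeta_eq_sum]
    calc ∑ n ∈ Finset.Ioc 0 N, (Λ * (ζ : ArithmeticFunction ℝ)) n
        ≤ ∑ n ∈ Finset.Ioc 0 N, Real.log N := by
          apply Finset.sum_le_sum
          intro n hn
          rw [vonMangoldt_mul_zeta, log_apply]
          have := Finset.mem_Ioc.mp hn
          exact Real.log_le_log (by exact_mod_cast this.1) (by exact_mod_cast this.2)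
      _ = N * Real.log N := by simp
  have h2 : ∑ n ∈ Finset.Ioc 0 N, Λ n / n * N ≤ 2 * (N * Real.log N) := by
    refine le_trans ?_ (mul_le_mul_of_nonneg_left h1 zero_le_two)
    rw [Finset.mul_sum]
    apply Finset.sum_le_sum
    intro n hn
    obtain ⟨hn0, hnN⟩ := Finset.mem_Ioc.mp hn
    have hn' : (0 : ℝ) < n := by exact_mod_cast hn0
    have h3 : (N : ℝ) ≤ 2 * ((N / n : ℕ) : ℝ) * n := by
      have h4 := Nat.div_add_mod N n
      have h5 := Nat.mod_lt N hn0
      have h6 : 1 ≤ N / n := Nat.div_pos hnN hn0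
      have h7 : N ≤ 2 * (N / n) * n := by nlinarith
      exact_mod_cast h7
    have h8 : (N : ℝ) / n ≤ 2 * ((N / n : ℕ) : ℝ) := by rwa [div_le_iff₀ hn']
    calc Λ n / n * N = Λ n * (N / n) := by ring
      _ ≤ Λ n * (2 * ((N / n : ℕ) : ℝ)) := mul_le_mul_of_nonneg_left h8 vonMangoldt_nonneg
      _ = _ := by ring
  rw [← Finset.sum_mul] at h2
  nlinarith

-- Split at n = log X. Small n fall under the previous bound; large n contribute at most ∑_{n∣f}
-- Λ(n) / log X = log f / log X ≤ 1.
open ArithmeticFunction ArithmeticFunction.zeta in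
theorem sum_divisors_vonMangoldt_div_le {f : ℕ} (hf : 0 < f) {X : ℝ} (hfX : f ≤ X)
    (hX : 1 ≤ Real.log X) :
    ∑ n ∈ f.divisors, Λ n / n ≤ 2 * Real.log (Real.log X) + 1 := by
  set y := Real.log X
  set N := ⌊y⌋₊
  have hN : 1 ≤ N := Nat.le_floor (by simpa using hX)
  have hNy : (N : ℝ) ≤ y := Nat.floor_le (by linarith)
  have h1 : ∑ n ∈ f.divisors with n ≤ N, Λ n / n ≤ 2 * Real.log y := by
    calc ∑ n ∈ f.divisors with n ≤ N, Λ n / n ≤ ∑ n ∈ Finset.Ioc 0 N, Λ n / n := by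
          apply Finset.sum_le_sum_of_subset_of_nonneg
          · intro n hn
            obtain ⟨h, h'⟩ := Finset.mem_filter.mp hn
            exact Finset.mem_Ioc.mpr ⟨Nat.pos_of_mem_divisors h, h'⟩
          · intro n _ _
            exact div_nonneg vonMangoldt_nonneg (Nat.cast_nonneg _)
      _ ≤ 2 * Real.log N := sum_vonMangoldt_div_le N
      _ ≤ 2 * Real.log y := by
          have := Real.log_le_log (show (0 : ℝ) < N by exact_mod_cast hN) hNy
          linarith
  have h2 : ∑ n ∈ f.divisors with ¬ n ≤ N, Λ n / n ≤ 1 := by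
    calc ∑ n ∈ f.divisors with ¬ n ≤ N, Λ n / n
        ≤ ∑ n ∈ f.divisors with ¬ n ≤ N, Λ n / y := by
          apply Finset.sum_le_sum
          intro n hn
          obtain ⟨h, h'⟩ := Finset.mem_filter.mp hn
          have : y ≤ n := (Nat.lt_of_floor_lt (not_le.mp h')).le
          exact div_le_div_of_nonneg_left vonMangoldt_nonneg (by linarith) this
      _ ≤ ∑ n ∈ f.divisors, Λ n / y := by
          apply Finset.sum_le_sum_of_subset_of_nonneg (Finset.filter_subset _ _)
          intro n _ _
          exact div_nonneg vonMangoldt_nonneg (by linarith)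
      _ ≤ 1 := by
          rw [← Finset.sum_div, vonMangoldt_sum, div_le_one (by linarith)]
          exact Real.log_le_log (by exact_mod_cast hf) hfX
  rw [← Finset.sum_filter_add_sum_filter_not f.divisors (· ≤ N)]
  linarith

-- Expand log d as the sum of Λ(n) over d = mn; the pairs (m, n) that arise are distinct pairs of
-- divisors of f.
open ArithmeticFunction ArithmeticFunction.zeta in
theorem sum_divisors_log_div_le (f : ℕ) :
    ∑ d ∈ f.divisors, Real.log d / d ≤
      (∑ d ∈ f.divisors, (1 : ℝ) / d) * ∑ n ∈ f.divisors, Λ n / n := by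
  calc ∑ d ∈ f.divisors, Real.log d / d
      = ∑ d ∈ f.divisors, ∑ x ∈ d.divisorsAntidiagonal, (1 / (x.1 : ℝ)) * (Λ x.2 / x.2) := by
        apply Finset.sum_congr rfl
        intro d hd
        rw [← vonMangoldt_sum, Finset.sum_div,
          Nat.sum_divisorsAntidiagonal' (fun i j : ℕ => (1 / (i : ℝ)) * (Λ j / j))]
        apply Finset.sum_congr rfl
        intro n hn
        have hn0 : (n : ℝ) ≠ 0 := by exact_mod_cast (Nat.pos_of_mem_divisors hn).ne'
        have hd0 : (d : ℝ) ≠ 0 := by exact_mod_cast (Nat.pos_of_mem_divisors hd).ne'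
        rw [Nat.cast_div (Nat.dvd_of_mem_divisors hn) hn0]
        field_simp
    _ = ∑ z ∈ f.divisors.sigma fun d => d.divisorsAntidiagonal,
          (1 / (z.2.1 : ℝ)) * (Λ z.2.2 / z.2.2) := by rw [Finset.sum_sigma]
    _ = ∑ x ∈ (f.divisors.sigma fun d => d.divisorsAntidiagonal).image Sigma.snd,
          (1 / (x.1 : ℝ)) * (Λ x.2 / x.2) := by
        rw [Finset.sum_image]
        rintro ⟨d, x⟩ hx ⟨d', x'⟩ hx' h
        simp only [Finset.coe_sigma, Set.mem_sigma_iff, Finset.mem_coe,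
          Nat.mem_divisorsAntidiagonal] at hx hx' h
        subst h
        rw [← hx.2.1, ← hx'.2.1]
    _ ≤ ∑ x ∈ f.divisors ×ˢ f.divisors, (1 / (x.1 : ℝ)) * (Λ x.2 / x.2) := by
        apply Finset.sum_le_sum_of_subset_of_nonneg
        · intro x hx
          obtain ⟨⟨d, x'⟩, hz, rfl⟩ := Finset.mem_image.mp hx
          simp only [Finset.mem_sigma, Nat.mem_divisorsAntidiagonal, Nat.mem_divisors] at hz
          obtain ⟨⟨hd, hf⟩, hx, -⟩ := hz
          simp only [Finset.mem_product, Nat.mem_divisors]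
          exact ⟨⟨(Dvd.intro _ hx).trans hd, hf⟩, (Dvd.intro_left _ hx).trans hd, hf⟩
        · intro x _ _
          exact mul_nonneg (by positivity) (div_nonneg vonMangoldt_nonneg (Nat.cast_nonneg _))
    _ = _ := by rw [Finset.sum_mul_sum, Finset.sum_product]

-- Markov's inequality: with weights 1/d, the mean of log d over d ∣ f is at most T, so the divisors
-- beyond e^{2T} carry at most half of S. The others carry at most a harmonic sum, 1 + 2T.
open ArithmeticFunction ArithmeticFunction.zeta in
theorem sum_divisors_inv_le_vonMangoldt (f : ℕ) :
    ∑ d ∈ f.divisors, (1 : ℝ) / d ≤ 2 + 4 * ∑ n ∈ f.divisors, Λ n / n := by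
  set T := ∑ n ∈ f.divisors, Λ n / n
  set S := ∑ d ∈ f.divisors, (1 : ℝ) / d
  have hT : 0 ≤ T := Finset.sum_nonneg fun n _ => div_nonneg vonMangoldt_nonneg (Nat.cast_nonneg _)
  set N := ⌊Real.exp (2 * T)⌋₊
  have hN : 1 ≤ N := Nat.le_floor (by simpa using hT)
  have h1 : ∑ d ∈ f.divisors with d ≤ N, (1 : ℝ) / d ≤ 1 + 2 * T := by
    calc ∑ d ∈ f.divisors with d ≤ N, (1 : ℝ) / d ≤ ∑ d ∈ Finset.Icc 1 N, (1 : ℝ) / d := by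
          apply Finset.sum_le_sum_of_subset_of_nonneg
          · intro n hn
            obtain ⟨h, h'⟩ := Finset.mem_filter.mp hn
            exact Finset.mem_Icc.mpr ⟨Nat.pos_of_mem_divisors h, h'⟩
          · intro n _ _
            positivity
      _ = (harmonic N : ℝ) := by simp [harmonic_eq_sum_Icc]
      _ ≤ 1 + Real.log N := harmonic_le_one_add_log N
      _ ≤ 1 + 2 * T := by
          have h := Real.log_le_log (show (0 : ℝ) < N by exact_mod_cast hN)
            (Nat.floor_le (Real.exp_pos (2 * T)).le)
          rw [Real.log_exp] at h
          linarith
  have h2 : 2 * T * ∑ d ∈ f.divisors with ¬ d ≤ N, (1 : ℝ) / d ≤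
      ∑ d ∈ f.divisors with ¬ d ≤ N, Real.log d / d := by
    rw [Finset.mul_sum]
    apply Finset.sum_le_sum
    intro d hd
    obtain ⟨h, h'⟩ := Finset.mem_filter.mp hd
    have hd0 : (0 : ℝ) < d := by exact_mod_cast Nat.pos_of_mem_divisors h
    have h3 : 2 * T ≤ Real.log d :=
      (Real.le_log_iff_exp_le hd0).mpr (Nat.lt_of_floor_lt (not_le.mp h')).le
    rw [mul_one_div]
    gcongr
  have h3 : ∑ d ∈ f.divisors with ¬ d ≤ N, Real.log d / d ≤ S * T := by
    refine le_trans ?_ (sum_divisors_log_div_le f)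
    apply Finset.sum_le_sum_of_subset_of_nonneg (Finset.filter_subset _ _)
    intro n _ _
    exact div_nonneg (Real.log_natCast_nonneg n) (Nat.cast_nonneg n)
  have h4 : S = _ := (Finset.sum_filter_add_sum_filter_not f.divisors (· ≤ N) _).symm
  -- Markov's inequality divides by T; when T = 0, Λ vanishes on all divisors of f, so f ≤ 1.
  rcases hT.eq_or_lt with h0 | h0
  · have h5 : S ≤ 1 := by
      have h6 : ∀ n ∈ f.divisors, Λ n = 0 := by
        intro n hn
        have h7 := (Finset.sum_eq_zero_iff_of_nonneg
          fun n _ => div_nonneg vonMangoldt_nonneg (Nat.cast_nonneg n)).mp h0.symm n hn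
        have h8 : (n : ℝ) ≠ 0 := by exact_mod_cast (Nat.pos_of_mem_divisors hn).ne'
        simpa [h8] using h7
      have h7 : Real.log f = 0 := by rw [← vonMangoldt_sum, Finset.sum_eq_zero h6]
      have h8 : f = 0 ∨ f = 1 := by
        by_contra! h
        exact (Real.log_pos (by exact_mod_cast (by omega : 1 < f))).ne' h7
      rcases h8 with rfl | rfl <;> simp [S]
    linarith
  · have h5 : ∑ d ∈ f.divisors with ¬ d ≤ N, (1 : ℝ) / d ≤ S / 2 := by
      refine le_of_mul_le_mul_left ?_ h0
      linarith
    linarith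

theorem sum_divisors_inv_le {f : ℕ} (hf : 0 < f) {X : ℝ} (hfX : f ≤ X)
    (hX : 1 ≤ Real.log X) :
    ∑ d ∈ f.divisors, (1 : ℝ) / d ≤ 8 * Real.log (Real.log X) + 6 := by
  have h1 := sum_divisors_inv_le_vonMangoldt f
  have h2 := sum_divisors_vonMangoldt_div_le hf hfX hX
  linarith

/-! ### Summing g(a) over an interval -/

/-- Bound g(a) by the sum of all d ∣ f with d² ∣ a and exchange sums. The main terms d·l/d² give the
divisor sum; the error terms d occur only for d ≤ √X, so they total at most √X·√X. -/
theorem sum_squareDivisor_le {A : Finset ℕ} {x l X : ℝ} (hl : 0 ≤ l) (hX : 0 ≤ X)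
    (hx : ∀ a ∈ A, x < a ∧ (a : ℝ) < x + l) (hA : ∀ a ∈ A, 0 < a ∧ (a : ℝ) ≤ X)
    {f : ℕ} (hf : f ≠ 0) (g : ℕ → ℕ) (hgf : ∀ a ∈ A, g a ∣ f) (hga : ∀ a ∈ A, g a ^ 2 ∣ a) :
    ∑ a ∈ A, (g a : ℝ) ≤ l * ∑ d ∈ f.divisors, (1 : ℝ) / d + X := by
  have count : ∀ d ∈ f.divisors, ((A.filter (d ^ 2 ∣ ·)).card : ℝ) * d ≤
      l * (1 / d) + if d ≤ ⌊√X⌋₊ then √X else 0 := by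
    intro d hd
    have hd0 : 0 < d := Nat.pos_of_mem_divisors hd
    have hd' : (0 : ℝ) < d := by exact_mod_cast hd0
    by_cases hdX : d ≤ ⌊√X⌋₊
    · rw [if_pos hdX]
      have h1 := card_le_of_dvd_sub ((A.filter (d ^ 2 ∣ ·)).image ((↑) : ℕ → ℤ)) (d ^ 2)
        (by positivity) x l hl
        (by
          intro t ht
          obtain ⟨a, ha, rfl⟩ := Finset.mem_image.mp ht
          exact_mod_cast hx a (Finset.mem_filter.mp ha).1)
        (by
          intro s hs t ht
          obtain ⟨a, ha, rfl⟩ := Finset.mem_image.mp hs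
          obtain ⟨a', ha', rfl⟩ := Finset.mem_image.mp ht
          exact dvd_sub (by exact_mod_cast (Finset.mem_filter.mp ha).2)
            (by exact_mod_cast (Finset.mem_filter.mp ha').2))
      rw [Finset.card_image_of_injective _ Nat.cast_injective] at h1
      push_cast at h1
      have h2 : (d : ℝ) ≤ √X := (Nat.le_floor_iff (Real.sqrt_nonneg X)).mp hdX
      calc ((A.filter (d ^ 2 ∣ ·)).card : ℝ) * d ≤ (l / d ^ 2 + 1) * d := by gcongr
        _ = l * (1 / d) + d := by field_simp
        _ ≤ _ := by linarith
    · have : A.filter (d ^ 2 ∣ ·) = ∅ := by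
        refine Finset.filter_eq_empty_iff.mpr fun a ha h => hdX ?_
        refine Nat.le_floor (Real.le_sqrt_of_sq_le ?_)
        refine le_trans ?_ (hA a ha).2
        exact_mod_cast Nat.le_of_dvd (hA a ha).1 h
      rw [this, if_neg hdX]
      simp; positivity
  calc ∑ a ∈ A, (g a : ℝ) ≤ ∑ a ∈ A, ∑ d ∈ f.divisors, if d ^ 2 ∣ a then (d : ℝ) else 0 := by
        apply Finset.sum_le_sum
        intro a ha
        have h := Finset.single_le_sum (s := f.divisors)
          (f := fun d : ℕ => if d ^ 2 ∣ a then (d : ℝ) else 0)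
          (fun d _ => by split_ifs <;> positivity) (Nat.mem_divisors.mpr ⟨hgf a ha, hf⟩)
        simpa [hga a ha] using h
    _ = ∑ d ∈ f.divisors, ((A.filter (d ^ 2 ∣ ·)).card : ℝ) * d := by
        rw [Finset.sum_comm]
        apply Finset.sum_congr rfl
        intro d _
        rw [← Finset.sum_filter, Finset.sum_const, nsmul_eq_mul]
    _ ≤ ∑ d ∈ f.divisors, (l * (1 / d) + if d ≤ ⌊√X⌋₊ then √X else 0) :=
        Finset.sum_le_sum count
    _ = l * ∑ d ∈ f.divisors, (1 : ℝ) / d + ∑ d ∈ f.divisors with d ≤ ⌊√X⌋₊, √X := by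
        rw [Finset.sum_add_distrib, ← Finset.mul_sum, Finset.sum_filter]
    _ ≤ l * ∑ d ∈ f.divisors, (1 : ℝ) / d + ∑ d ∈ Finset.Icc 1 ⌊√X⌋₊, √X := by
        refine add_le_add le_rfl ?_
        apply Finset.sum_le_sum_of_subset_of_nonneg
        · intro d hd
          obtain ⟨h, h'⟩ := Finset.mem_filter.mp hd
          exact Finset.mem_Icc.mpr ⟨Nat.pos_of_mem_divisors h, h'⟩
        · intro d _ _
          positivity
    _ ≤ l * ∑ d ∈ f.divisors, (1 : ℝ) / d + X := by
        refine add_le_add le_rfl ?_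
        rw [Finset.sum_const, nsmul_eq_mul, Nat.card_Icc, Nat.add_sub_cancel]
        calc (⌊√X⌋₊ : ℝ) * √X ≤ √X * √X := by
              gcongr; exact Nat.floor_le (Real.sqrt_nonneg X)
          _ = X := Real.mul_self_sqrt hX

/-! ### From points near ξ to conditions on (a, b), and the final count -/

theorem sq_sqrt_abs_cast (Δ : ℤ) (hΔ : Δ < 0) : √|(Δ : ℝ)| ^ 2 = -Δ := by
  rw [Real.sq_sqrt (abs_nonneg _), abs_of_neg (by exact_mod_cast hΔ)]

theorem formPoint_re (Δ a b : ℤ) : (formPoint Δ a b).re = -b / (2 * a) := by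
  have : formPoint Δ a b =
      ((-b / (2 * a) : ℝ) : ℂ) + ((√|(Δ : ℝ)| / (2 * a) : ℝ) : ℂ) * Complex.I := by
    simp only [formPoint]; push_cast; ring
  rw [this]; simp [-Complex.ofReal_div, -Complex.ofReal_neg, -Complex.ofReal_mul]

theorem formPoint_im (Δ a b : ℤ) : (formPoint Δ a b).im = √|(Δ : ℝ)| / (2 * a) := by
  have : formPoint Δ a b =
      ((-b / (2 * a) : ℝ) : ℂ) + ((√|(Δ : ℝ)| / (2 * a) : ℝ) : ℂ) * Complex.I := by
    simp only [formPoint]; push_cast; ring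
  rw [this]; simp [-Complex.ofReal_div, -Complex.ofReal_neg, -Complex.ofReal_mul]

theorem two_pow_omega_le_maxTwoPowOmega {Δ : ℤ} {a : ℕ} (ha : 0 < a) (haX : (a : ℝ) ≤ √|(Δ : ℝ)|) :
    (2 : ℝ) ^ ω a ≤ maxTwoPowOmega Δ := by
  have : 2 ^ ω a ≤ maxTwoPowOmega Δ :=
    Finset.le_sup (f := fun a => 2 ^ ω a) (Finset.mem_Icc.mpr ⟨ha, Nat.le_floor haX⟩)
  exact_mod_cast this

/-- The conditions on `(a, b)` used to bound the number of forms `(a, b, c)` of discriminant `Δ`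
whose point is at distance less than `ε` from `ξ`. -/
theorem bounds_of_norm_formPoint_sub_lt {Δ a b c : ℤ} {ξ : ℂ} {ε : ℝ} (hΔ : Δ < 0) (ha : 0 < a)
    (hac : a ≤ c) (hb : |b| ≤ a) (hD : b ^ 2 - 4 * a * c = Δ) (hε : ε < ξ.im) (hε0 : 0 < ε)
    (h : ‖formPoint Δ a b - ξ‖ < ε) :
    (a : ℝ) ≤ √|(Δ : ℝ)| ∧
    (√|(Δ : ℝ)| / (2 * (ξ.im + ε)) < a ∧ (a : ℝ) < √|(Δ : ℝ)| / (2 * (ξ.im - ε))) ∧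
    -(2 * a * (ξ.re + ε)) < b ∧ (b : ℝ) < -(2 * a * (ξ.re + ε)) + 4 * a * ε := by
  have ha' : (0 : ℝ) < a := by exact_mod_cast ha
  have hre := (Complex.abs_re_le_norm _).trans_lt h
  have him := (Complex.abs_im_le_norm _).trans_lt h
  rw [Complex.sub_re, formPoint_re, abs_lt] at hre
  rw [Complex.sub_im, formPoint_im, abs_lt] at him
  have e1 : -(b : ℝ) / (2 * a) * (2 * a) = -b := by field_simp
  have e2 : √|(Δ : ℝ)| / (2 * a) * (2 * a) = √|(Δ : ℝ)| := by field_simp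
  set X := √|(Δ : ℝ)|
  refine ⟨?_, ⟨?_, ?_⟩, ?_, ?_⟩
  · have hb2 : b ^ 2 ≤ a ^ 2 := sq_le_sq.mpr (by rwa [abs_of_pos ha])
    -- Reducedness gives -Δ = 4ac - b² ≥ 3a².
    have h1 : a ^ 2 ≤ -Δ := by nlinarith
    have h2 : (a : ℝ) ^ 2 ≤ -Δ := by exact_mod_cast h1
    rw [← sq_sqrt_abs_cast Δ hΔ] at h2
    exact (sq_le_sq₀ ha'.le (Real.sqrt_nonneg _)).mp h2
  · rw [div_lt_iff₀ (by linarith)]; nlinarith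
  · rw [lt_div_iff₀ (by linarith)]; nlinarith
  · nlinarith
  · nlinarith

theorem mainTheorem6 (Δ : ℤ) (hΔneg : Δ < 0) (hΔ : (10 : ℝ) ^ 14 ≤ |(Δ : ℝ)|)
    (ξ : UpperHalfPlane) (hξ : ξ ∈ 𝒟) (ε : ℝ) (hε : 0 < ε) (hε' : ε < 1 / 4) :
    (cmCount Δ ξ ε : ℝ) ≤
      (maxTwoPowOmega Δ : ℝ) *
        (32 * √|(Δ : ℝ)| * ε ^ 2 * Real.log (Real.log (√|(Δ : ℝ)|)) +
          11 * √|(Δ : ℝ)| * ε + 2) := by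
  classical
  set X := √|(Δ : ℝ)|
  set F : ℝ := (maxTwoPowOmega Δ : ℝ)
  have hX7 : (10 : ℝ) ^ 7 ≤ X := Real.le_sqrt_of_sq_le (by norm_num; norm_num at hΔ; exact hΔ)
  have hX0 : 0 < X := by linarith [show (0 : ℝ) < 10 ^ 7 by norm_num]
  have hlogX : 1 ≤ Real.log X := by
    rw [Real.le_log_iff_exp_le hX0]
    linarith [Real.exp_one_lt_d9, show (3 : ℝ) ≤ 10 ^ 7 by norm_num]
  set y := (ξ : ℂ).im
  have hy2 : 3 / 4 ≤ y ^ 2 := by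
    obtain ⟨h1, h2⟩ := hξ
    rw [← UpperHalfPlane.coe_re, abs_le] at h2
    have h3 : (ξ : ℂ).re ^ 2 ≤ (1 / 2) ^ 2 := sq_le_sq' (by linarith) h2.2
    rw [Complex.normSq_apply] at h1
    nlinarith
  have hy0 : 0 < y := ξ.im_pos
  have hyε : 1 / 4 < y := by nlinarith
  have hfin : {q ∈ reducedForms Δ | ‖formPoint Δ q.1 q.2.1 - (ξ : ℂ)‖ < ε}.Finite :=
    (reducedForms_finite Δ).subset fun q hq => hq.1
  set Q := hfin.toFinset
  have hcount : cmCount Δ ξ ε = Q.card := Set.ncard_eq_toFinset_card _ hfin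
  have bounds : ∀ q ∈ Q, ∃ a : ℕ, 0 < a ∧ q.1 = a ∧ (a : ℝ) ≤ X ∧
      (X / (2 * (y + ε)) < a ∧ (a : ℝ) < X / (2 * (y - ε))) ∧
      q.2.1 ^ 2 - 4 * a * q.2.2 = Δ ∧ -(2 * a * ((ξ : ℂ).re + ε)) < q.2.1 ∧
      (q.2.1 : ℝ) < -(2 * a * ((ξ : ℂ).re + ε)) + 4 * a * ε := by
    rintro ⟨a, b, c⟩ hq
    obtain ⟨⟨⟨ha, -⟩, -, ⟨hb, hac, -⟩, hD⟩, hn⟩ := hfin.mem_toFinset.mp hq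
    simp only at ha hb hac hD hn
    lift a to ℕ using ha.le
    obtain ⟨h1, h2, h3⟩ := bounds_of_norm_formPoint_sub_lt hΔneg ha hac hb hD
      (hε'.trans hyε) hε hn
    rw [Int.cast_natCast] at h1 h2 h3
    exact ⟨a, by exact_mod_cast ha, rfl, h1, h2, hD, h3⟩
  set A := Q.image fun q => q.1.toNat
  have hAb : ∀ a ∈ A, (0 < a ∧ (a : ℝ) ≤ X) ∧
      X / (2 * (y + ε)) < a ∧ (a : ℝ) < X / (2 * (y - ε)) := by
    intro a ha
    obtain ⟨q, hq, rfl⟩ := Finset.mem_image.mp ha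
    obtain ⟨a, ha0, hqa, h1, h2, -⟩ := bounds q hq
    rw [hqa, Int.toNat_natCast]
    exact ⟨⟨ha0, h1⟩, h2⟩
  -- Here `g a` squared is the largest square dividing gcd(a, Δ), and below f squared is the largest
  -- dividing Δ; the cofactors `r a` and s are squarefree.
  choose r g hgr hr using fun a : ℕ => Nat.sq_mul_squarefree (Nat.gcd a Δ.natAbs)
  obtain ⟨s, f, hfs, hs⟩ := Nat.sq_mul_squarefree Δ.natAbs
  have hf0 : f ≠ 0 := by rintro rfl; simp at hfs; omega
  have hfX : (f : ℝ) ≤ X := by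
    apply Real.le_sqrt_of_sq_le
    have h1 : f ^ 2 ≤ Δ.natAbs := Nat.le_of_dvd (by omega) (Dvd.intro _ hfs)
    have h2 : ((f ^ 2 : ℕ) : ℝ) ≤ (Δ.natAbs : ℝ) := by exact_mod_cast h1
    rw [Nat.cast_natAbs] at h2
    push_cast at h2
    exact h2
  have fibre : ∀ a ∈ A, (({q ∈ Q | q.1.toNat = a} : Finset _).card : ℝ) ≤
      F * (2 * ε * g a + 1) := by
    intro a ha
    obtain ⟨⟨ha0, haX⟩, -⟩ := hAb a ha
    have ha0' : (0 : ℝ) < a := by exact_mod_cast ha0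
    have hinj : Set.InjOn (fun q : ℤ × ℤ × ℤ => q.2.1) {q ∈ Q | q.1.toNat = a} := by
      rintro ⟨a₁, b₁, c₁⟩ hq ⟨a₂, b₂, c₂⟩ hq' h
      obtain ⟨hq, e⟩ := hq
      obtain ⟨hq', e'⟩ := hq'
      obtain ⟨a₁, h0, rfl, -, -, hD, -⟩ := bounds _ hq
      obtain ⟨a₂, h0', rfl, -, -, hD', -⟩ := bounds _ hq'
      simp only [Int.toNat_natCast] at e e' h hD hD'
      subst e e' h
      have : (4 * a₂ : ℤ) * c₁ = 4 * a₂ * c₂ := by linarith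
      have := mul_left_cancel₀ (by positivity) this
      rw [this]
    have h1 := card_sqrt_mod_le (hr a) ha0 (hgr a)
      (({q ∈ Q | q.1.toNat = a} : Finset _).image fun q => q.2.1)
      (-(2 * a * ((ξ : ℂ).re + ε))) (4 * a * ε) (by positivity)
      (by
        intro b hb
        obtain ⟨q, hq, rfl⟩ := Finset.mem_image.mp hb
        obtain ⟨hq, e⟩ := Finset.mem_filter.mp hq
        obtain ⟨a', -, hqa, -, -, hD, -⟩ := bounds q hq
        rw [hqa, Int.toNat_natCast] at e
        subst e
        exact ⟨q.2.2, by linarith⟩)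
      (by
        intro b hb
        obtain ⟨q, hq, rfl⟩ := Finset.mem_image.mp hb
        obtain ⟨hq, e⟩ := Finset.mem_filter.mp hq
        obtain ⟨a', -, hqa, -, -, -, h⟩ := bounds q hq
        rw [hqa, Int.toNat_natCast] at e
        subst e
        exact h)
    rw [Finset.card_image_of_injOn (by simpa using hinj)] at h1
    refine h1.trans ?_
    rw [show 4 * (a : ℝ) * ε * g a / (2 * a) = 2 * ε * g a by field_simp; ring]
    exact mul_le_mul_of_nonneg_right (two_pow_omega_le_maxTwoPowOmega ha0 haX) (by positivity)
  set l := X / (2 * (y - ε)) - X / (2 * (y + ε)) with hl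
  have hl1 : l ≤ 16 / 11 * X * ε := by
    have : l = X * ε / (y ^ 2 - ε ^ 2) := by
      rw [hl, show y ^ 2 - ε ^ 2 = (y - ε) * (y + ε) by ring]
      have h1 : y - ε ≠ 0 := by linarith
      have h2 : y + ε ≠ 0 := by linarith
      field_simp; ring
    rw [this, div_le_iff₀ (by nlinarith)]
    -- 11/16 = 3/4 - (1/4)², from y² ≥ 3/4 on the fundamental domain.
    have : 11 / 16 ≤ y ^ 2 - ε ^ 2 := by nlinarith
    nlinarith [mul_pos hX0 hε]
  have hl0 : 0 ≤ l := sub_nonneg.mpr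
    (div_le_div_of_nonneg_left hX0.le (by linarith) (by linarith))
  have hAx : ∀ a ∈ A, X / (2 * (y + ε)) < a ∧ (a : ℝ) < X / (2 * (y + ε)) + l := by
    intro a ha
    have := (hAb a ha).2
    exact ⟨this.1, by linarith [this.2]⟩
  have hAcard : (A.card : ℝ) ≤ l + 1 := by
    have h := card_le_of_dvd_sub (A.image ((↑) : ℕ → ℤ)) 1 one_pos _ l hl0
      (by
        intro t ht
        obtain ⟨a, ha, rfl⟩ := Finset.mem_image.mp ht
        exact_mod_cast hAx a ha) (fun _ _ _ _ => one_dvd _)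
    rw [Finset.card_image_of_injective _ Nat.cast_injective] at h
    simpa using h
  have hG := sum_squareDivisor_le hl0 hX0.le hAx (fun a ha => (hAb a ha).1) hf0 g
    (fun a _ => dvd_of_sq_dvd_sq_mul hs (by
      rw [hfs]; exact (Dvd.intro _ (hgr a)).trans (Nat.gcd_dvd_right _ _)))
    (fun a _ => (Dvd.intro _ (hgr a)).trans (Nat.gcd_dvd_left _ _))
  have hS := sum_divisors_inv_le (Nat.pos_of_ne_zero hf0) hfX hlogX
  have hL : 0 ≤ Real.log (Real.log X) := Real.log_nonneg hlogX
  set L := Real.log (Real.log X)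
  set S := ∑ d ∈ f.divisors, (1 : ℝ) / d
  have hF0 : 0 ≤ F := Nat.cast_nonneg _
  calc (cmCount Δ ξ ε : ℝ) = ∑ a ∈ A, (({q ∈ Q | q.1.toNat = a} : Finset _).card : ℝ) := by
        rw [hcount, Finset.card_eq_sum_card_image (fun q => q.1.toNat) Q, Nat.cast_sum]
    _ ≤ ∑ a ∈ A, F * (2 * ε * g a + 1) := Finset.sum_le_sum fibre
    _ = F * (2 * ε * ∑ a ∈ A, (g a : ℝ) + A.card) := by
        rw [← Finset.mul_sum, Finset.sum_add_distrib, ← Finset.mul_sum]; simp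
    _ ≤ F * (2 * ε * (16 / 11 * X * ε * (8 * L + 6) + X) + (16 / 11 * X * ε + 1)) := by
        have hS0 : 0 ≤ S := Finset.sum_nonneg fun d _ => by positivity
        have h1 : l * S ≤ 16 / 11 * X * ε * (8 * L + 6) :=
          mul_le_mul hl1 hS hS0 (by positivity)
        gcongr
        · linarith
        · linarith
    -- There is slack: 256/11 < 32 for ε²L, and, using ε < 1/4, 48/11 + 2 + 16/11 < 11 for ε.
    _ ≤ F * (32 * X * ε ^ 2 * L + 11 * X * ε + 2) := by
        apply mul_le_mul_of_nonneg_left _ hF0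
        have h1 : 0 ≤ X * ε ^ 2 * L := by positivity
        have h2 : X * ε ^ 2 ≤ X * ε * (1 / 4) := by
          rw [sq, ← mul_assoc]; exact mul_le_mul_of_nonneg_left hε'.le (by positivity)
        have h3 : 0 ≤ X * ε := by positivity
        nlinarith
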